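/- **Theorem 6.4 (change of coefficients).** Let $1\to F\xrightarrow{\kappa} G\xrightarrow{\zeta} H\to 1$ be a central extension of finite-dimensional real Lie groups with $H$ compact and $F$ discrete: $\kappa$ is a topological embedding of the discrete group $F$ onto $\ker\zeta$, which is central in $G$, and $\zeta$ is a smooth surjective open homomorphism. Fix a biinvariant Riemannian metric on $H$ and pull it back to $G$ along $\zeta$. Let $d_H$, $d_G$ be the geodesic distances (with value $\infty$ between different components), and give $F$ the distance inherited from $G$. Let $\mathsf{sys}(H)\in[0,\infty]$ be the infimum of the lengths of the non-nullhomotopic loops in $(H,d_H)$ ($\infty$ if there are none). Let $\mathcal U=\{U_i\}$ be an open cover of a topological space $B$ such that every nonempty $U_i$ and every nonempty $U_i\cap U_j$ is locally path connected and simply connected. For a topological group $K$, let $C^1(\mathcal U;K)$ be the set of families of continuous maps $\Omega_{ij}:U_i\cap U_j\to K$, indexed by ordered pairs $(i,j)$, with $\Omega_{ij}=\Omega_{ji}^{-1}$. For $\epsilon\in[0,\infty]$ let $Z^1_\epsilon(\mathcal U;H)$ be the set of $\Omega\in C^1(\mathcal U;H)$ with $d_H(\Omega_{ij}(y)\Omega_{jk}(y),\Omega_{ik}(y))<\epsilon$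 for all $i,j,k$ and $y\in U_i\cap U_j\cap U_k$ (with equality $\Omega_{ij}\Omega_{jk}=\Omega_{ik}$ instead, if $\epsilon=0$). Let $\check H^1_\epsilon(\mathcal U;H)$ be its quotient by the action $(\Theta\cdot\Omega)_{ij}=\Theta_i\Omega_{ij}\Theta_j^{-1}$ of families of continuous maps $\Theta_i:U_i\to H$. Put $d_Z(\Omega,\Omega')=\sup_{i,j}\sup_{y\in U_i\cap U_j}d_H(\Omega_{ij}(y),\Omega'_{ij}(y))$, and let $d_{\check H}$ of two classes be the infimum of $d_Z$ over representatives in $Z^1_\epsilon(\mathcal U;H)$. Let $Z^2(\mathcal U;F)$ be the group of families of locally constant $\Gamma_{ijk}:U_i\cap U_j\cap U_k\to F$ with $\Gamma_{ijk}\Gamma_{ijl}^{-1}\Gamma_{ikl}\Gamma_{jkl}^{-1}=1$ on $U_i\cap U_j\cap U_k\cap U_l$, and let $\check H^2(\mathcal U;F)$ be its quotient by the cocycles $f_{ij}f_{jk}f_{ki}$ with $f\in C^1(\mathcal U;F)$. Let $\epsilon\le\mathsf{sys}(H)/8$. Then: 1. Every $\Omega\in Z^1_\epsilon(\mathcal U;H)$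 has a lift, i.e. a $\Lambda\in C^1(\mathcal U;G)$ with $\zeta\circ\Lambda_{ij}=\Omega_{ij}$ for all $i,j$. 2. For every such $\Omega$, every lift $\Lambda$, all $i,j,k$ and $y\in U_i\cap U_j\cap U_k$, there is a unique point $\Gamma_{ijk}(y)$ of $F$ closest to $\Lambda_{ij}(y)\Lambda_{jk}(y)\Lambda_{ki}(y)$ in $d_G$, and $\Gamma=(\Gamma_{ijk})$ belongs to $Z^2(\mathcal U;F)$. 3. There is a unique map $\partial:\check H^1_\epsilon(\mathcal U;H)\to\check H^2(\mathcal U;F)$ with $\partial[\Omega]=[\Gamma]$ for every $\Omega\in Z^1_\epsilon(\mathcal U;H)$ and every lift $\Lambda$ of $\Omega$, where $\Gamma$ is obtained from $\Lambda$ as in 2. In particular $\partial$ is independent of the lifts. 4. If $a,b\in\check H^1_\epsilon(\mathcal U;H)$ satisfy $d_{\check H}(a,b)<\mathsf{sys}(H)/8$, then $\partial a=\partial b$. -/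

import Mathlib

open scoped Manifold ContDiff ENNReal
open TopologicalSpace Bundle

namespace ApproxCech

universe u v w

section Cochains

variable {B : Type u} [TopologicalSpace B] {J : Type v} (U : J → Opens B)
variable (G : Type w) [Group G]

/-- Symmetric Čech `1`-cochains: continuous `Ω i j : U i ∩ U j → G` with `Ω i j = (Ω j i)⁻¹`.
A pair with `U i ∩ U j = ∅` carries no information: there is exactly one map `∅ → G`. -/
@[ext]
structure Cochain1 [TopologicalSpace G] where
  val : ∀ i j : J, C(↥(U i ⊓ U j), G)
  symm : ∀ (i j : J) (y : B) (hi : y ∈ U i) (hj : y ∈ U j),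
    val i j ⟨y, hi, hj⟩ = (val j i ⟨y, hj, hi⟩)⁻¹

/-- Čech `0`-cochains: families of continuous maps `U i → G`. -/
abbrev Cochain0 [TopologicalSpace G] := ∀ i : J, C(↥(U i), G)

variable {U G}

/-- `ε`-approximate cocycles: `d(Ω i j · Ω j k, Ω i k) < ε` pointwise on triple intersections
when `ε > 0`, and exact cocycles when `ε = 0`. -/
def IsApproxCocycle [EMetricSpace G] (ε : ℝ≥0∞) (Ω : Cochain1 U G) : Prop :=
  ∀ (i j k : J) (y : B) (hi : y ∈ U i) (hj : y ∈ U j) (hk : y ∈ U k),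
    (ε = 0 → Ω.val i j ⟨y, hi, hj⟩ * Ω.val j k ⟨y, hj, hk⟩ = Ω.val i k ⟨y, hi, hk⟩) ∧
    (ε ≠ 0 → edist (Ω.val i j ⟨y, hi, hj⟩ * Ω.val j k ⟨y, hj, hk⟩) (Ω.val i k ⟨y, hi, hk⟩) < ε)

variable (U G) in
/-- The set of `ε`-approximate `1`-cocycles. -/
def Z1 [EMetricSpace G] (ε : ℝ≥0∞) := {Ω : Cochain1 U G // IsApproxCocycle ε Ω}

/-- `Λ` is obtained from `Ω` by the action of the `0`-cochain `Θ`: `Λ i j = Θ i · Ω i j · (Θ j)⁻¹`. -/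
def IsTranslate [TopologicalSpace G] (Θ : Cochain0 U G) (Ω Λ : Cochain1 U G) : Prop :=
  ∀ (i j : J) (y : B) (hi : y ∈ U i) (hj : y ∈ U j),
    Λ.val i j ⟨y, hi, hj⟩ = Θ i ⟨y, hi⟩ * Ω.val i j ⟨y, hi, hj⟩ * (Θ j ⟨y, hj⟩)⁻¹

variable (U G) in
/-- The orbit relation of the action of `0`-cochains on `ε`-approximate `1`-cocycles. -/
def Z1.setoid [EMetricSpace G] [IsTopologicalGroup G] (ε : ℝ≥0∞) : Setoid (Z1 U G ε) where
  r Ω Λ := ∃ Θ : Cochain0 U G, IsTranslate Θ Ω.1 Λ.1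
  iseqv :=
    { refl := fun Ω => ⟨fun _ => 1, fun i j y hi hj => by simp⟩
      symm := by
        rintro Ω Λ ⟨Θ, h⟩
        refine ⟨fun i => (Θ i)⁻¹, fun i j y hi hj => ?_⟩
        rw [h i j y hi hj]
        simp only [ContinuousMap.inv_apply]
        group
      trans := by
        rintro Ω Λ Ξ ⟨Θ, h⟩ ⟨Θ', h'⟩
        refine ⟨fun i => Θ' i * Θ i, fun i j y hi hj => ?_⟩
        rw [h' i j y hi hj, h i j y hi hj]
        simp only [ContinuousMap.mul_apply]
        group }

variable (U G) in
/-- The `ε`-approximate cohomology set. -/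
def H1 [EMetricSpace G] [IsTopologicalGroup G] (ε : ℝ≥0∞) := Quotient (Z1.setoid U G ε)

/-- The class of an `ε`-approximate cocycle. -/
def H1.mk [EMetricSpace G] [IsTopologicalGroup G] {ε : ℝ≥0∞} (Ω : Z1 U G ε) : H1 U G ε :=
  Quotient.mk (Z1.setoid U G ε) Ω

/-- The uniform distance between `1`-cochains. -/
noncomputable def distZ [EMetricSpace G] (Ω Λ : Cochain1 U G) : ℝ≥0∞ :=
  ⨆ (i : J) (j : J) (y : ↥(U i ⊓ U j)), edist (Ω.val i j y) (Λ.val i j y)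

/-- The distance between approximate cohomology classes: the infimum of the distances between
representatives. -/
noncomputable def distH [EMetricSpace G] [IsTopologicalGroup G] {ε : ℝ≥0∞} (a b : H1 U G ε) :
    ℝ≥0∞ :=
  ⨅ (Ω : Z1 U G ε) (Λ : Z1 U G ε) (_ : H1.mk Ω = a) (_ : H1.mk Λ = b), distZ Ω.1 Λ.1

end Cochains

section SecondCohomology

variable {B : Type u} [TopologicalSpace B] {J : Type v} (U : J → Opens B)
variable (A : Type w) [CommGroup A] [TopologicalSpace A] [IsTopologicalGroup A]

/-- Čech `2`-cochains: families of continuous maps `U i ∩ U j ∩ U k → A`. When `A` is discrete,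
continuous means locally constant. -/
abbrev Cochain2 := ∀ i j k : J, C(↥(U i ⊓ U j ⊓ U k), A)

/-- Čech `2`-cocycles. -/
def Z2 : Subgroup (Cochain2 U A) where
  carrier := {Γ | ∀ (i j k l : J) (y : B) (hi : y ∈ U i) (hj : y ∈ U j) (hk : y ∈ U k)
    (hl : y ∈ U l),
      Γ i j k ⟨y, ⟨hi, hj⟩, hk⟩ * (Γ i j l ⟨y, ⟨hi, hj⟩, hl⟩)⁻¹ * Γ i k l ⟨y, ⟨hi, hk⟩, hl⟩ *
        (Γ j k l ⟨y, ⟨hj, hk⟩, hl⟩)⁻¹ = 1}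
  one_mem' := by intro i j k l y hi hj hk hl; simp
  mul_mem' := by
    intro Γ Δ hΓ hΔ i j k l y hi hj hk hl
    have h := congrArg₂ (· * ·) (hΓ i j k l y hi hj hk hl) (hΔ i j k l y hi hj hk hl)
    simp only [mul_one] at h
    rw [← h]
    simp only [Pi.mul_apply, ContinuousMap.mul_apply, mul_inv]
    ac_rfl
  inv_mem' := by
    intro Γ hΓ i j k l y hi hj hk hl
    have h := congrArg (·⁻¹) (hΓ i j k l y hi hj hk hl)
    simp only [inv_one] at h
    rw [← h]
    simp only [Pi.inv_apply, ContinuousMap.inv_apply, mul_inv]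

/-- Čech `2`-coboundaries: the cochains `Ω i j · Ω j k · Ω k i` with `Ω` a symmetric `1`-cochain.
As `Ω k i = (Ω i k)⁻¹`, this is the usual coboundary of `Ω`. -/
def B2 : Subgroup (Cochain2 U A) where
  carrier := {Γ | ∃ Ω : Cochain1 U A, ∀ (i j k : J) (y : B) (hi : y ∈ U i) (hj : y ∈ U j)
    (hk : y ∈ U k), Γ i j k ⟨y, ⟨hi, hj⟩, hk⟩ =
      Ω.val i j ⟨y, hi, hj⟩ * Ω.val j k ⟨y, hj, hk⟩ * Ω.val k i ⟨y, hk, hi⟩}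
  one_mem' := ⟨⟨fun _ _ => 1, by simp⟩, by simp⟩
  mul_mem' := by
    rintro Γ Δ ⟨Ω, hΩ⟩ ⟨Λ, hΛ⟩
    refine ⟨⟨fun i j => Ω.val i j * Λ.val i j, fun i j y hi hj => ?_⟩,
      fun i j k y hi hj hk => ?_⟩
    · simp only [ContinuousMap.mul_apply]
      rw [Ω.symm i j y hi hj, Λ.symm i j y hi hj, mul_inv]
    · simp only [Pi.mul_apply, ContinuousMap.mul_apply]
      rw [hΩ i j k y hi hj hk, hΛ i j k y hi hj hk]
      ac_rfl
  inv_mem' := by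
    rintro Γ ⟨Ω, hΩ⟩
    refine ⟨⟨fun i j => (Ω.val i j)⁻¹, fun i j y hi hj => ?_⟩, fun i j k y hi hj hk => ?_⟩
    · simp only [ContinuousMap.inv_apply]
      rw [Ω.symm i j y hi hj]
    · simp only [Pi.inv_apply, ContinuousMap.inv_apply]
      rw [hΩ i j k y hi hj hk, mul_inv, mul_inv]

theorem B2_le_Z2 : B2 U A ≤ Z2 U A := by
  rintro Γ ⟨Ω, hΩ⟩ i j k l y hi hj hk hl
  rw [hΩ i j k y hi hj hk, hΩ i j l y hi hj hl, hΩ i k l y hi hk hl, hΩ j k l y hj hk hl,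
    Ω.symm k i y hk hi, Ω.symm l j y hl hj, Ω.symm l i y hl hi]
  simp only [mul_inv, inv_inv]
  generalize Ω.val i j _ = a, Ω.val j k _ = b, Ω.val i k _ = c, Ω.val j l _ = d,
    Ω.val i l _ = e, Ω.val k l _ = f
  rw [← ofMul_eq_zero]
  simp only [ofMul_mul, ofMul_inv]
  abel

/-- Second Čech cohomology of the cover: cocycles modulo coboundaries. -/
abbrev H2 := ↥(Z2 U A) ⧸ (B2 U A).subgroupOf (Z2 U A)

end SecondCohomology

section Cover

variable {B : Type u} [TopologicalSpace B] {J : Type v}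

/-- Every nonempty member and every nonempty binary intersection of members of the family is
locally path connected and simply connected. -/
structure IsGoodFamily (U : J → Opens B) : Prop where
  single : ∀ i, Nonempty ↥(U i) →
    LocallyPathConnectedSpace ↥(U i) ∧ SimplyConnectedSpace ↥(U i)
  inter : ∀ i j, Nonempty ↥(U i ⊓ U j) →
    LocallyPathConnectedSpace ↥(U i ⊓ U j) ∧ SimplyConnectedSpace ↥(U i ⊓ U j)

end Cover

section Geometry

/-- The systole of an (extended) metric space: the infimum of the lengths of the continuous loops
that are not nullhomotopic; it is `∞` if there are none. -/
noncomputable def systole (M : Type u) [EMetricSpace M] : ℝ≥0∞ :=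
  ⨅ (x : M) (γ : Path x x) (_ : ¬ γ.Homotopic (Path.refl x)), eVariationOn γ Set.univ

variable {E : Type u} [NormedAddCommGroup E] [NormedSpace ℝ E]
variable (H : Type v) [TopologicalSpace H] [ChartedSpace E H] [Group H] [LieGroup 𝓘(ℝ, E) ∞ H]
variable [RiemannianBundle (fun x : H ↦ TangentSpace 𝓘(ℝ, E) x)]

variable (E) in
/-- The Riemannian metric on the Lie group is invariant under left and right translations. -/
def IsBiinvariant : Prop :=
  (∀ (a x : H) (v w : TangentSpace 𝓘(ℝ, E) x),
    inner ℝ (mfderiv 𝓘(ℝ, E) 𝓘(ℝ, E) (fun h : H ↦ a * h) x v)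
      (mfderiv 𝓘(ℝ, E) 𝓘(ℝ, E) (fun h : H ↦ a * h) x w) = inner ℝ v w) ∧
  (∀ (a x : H) (v w : TangentSpace 𝓘(ℝ, E) x),
    inner ℝ (mfderiv 𝓘(ℝ, E) 𝓘(ℝ, E) (fun h : H ↦ h * a) x v)
      (mfderiv 𝓘(ℝ, E) 𝓘(ℝ, E) (fun h : H ↦ h * a) x w) = inner ℝ v w)

variable {H}
variable {E' : Type*} [NormedAddCommGroup E'] [NormedSpace ℝ E']
variable {G : Type*} [TopologicalSpace G] [ChartedSpace E' G] [Group G]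
  [LieGroup 𝓘(ℝ, E') ∞ G]
variable [RiemannianBundle (fun x : G ↦ TangentSpace 𝓘(ℝ, E') x)]

variable (E E') in
/-- The Riemannian metric on `G` is the pullback along `ζ` of the Riemannian metric on `H`. -/
def IsPullbackMetric (ζ : G →* H) : Prop :=
  ∀ (g : G) (v w : TangentSpace 𝓘(ℝ, E') g),
    inner ℝ v w = inner ℝ (mfderiv 𝓘(ℝ, E') 𝓘(ℝ, E) ζ g v) (mfderiv 𝓘(ℝ, E') 𝓘(ℝ, E) ζ g w)

variable (E E') in
/-- `F → G → H` is a central extension of Lie groups: `F` (discrete, so that there is nothing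
smooth to ask of `κ`) is topologically embedded as a central subgroup of `G`, and `ζ` is a smooth
surjective open homomorphism with kernel the image of `F`. -/
structure IsCentralExtension {F : Type*} [CommGroup F] [TopologicalSpace F]
    (κ : F →* G) (ζ : G →* H) : Prop where
  isEmbedding : Topology.IsEmbedding κ
  central : ∀ f, κ f ∈ Subgroup.center G
  exact : κ.range = ζ.ker
  surjective : Function.Surjective ζ
  smooth : ContMDiff 𝓘(ℝ, E') 𝓘(ℝ, E) ∞ ζ
  isOpenMap : IsOpenMap ζ

end Geometry

section Connecting

variable {B : Type u} [TopologicalSpace B] {J : Type v} {U : J → Opens B}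
variable {F G H : Type*} [CommGroup F] [Group G] [Group H]

/-- The symmetric `G`-cochain `Λ` lifts the symmetric `H`-cochain `Ω`. -/
def IsLift [TopologicalSpace G] [TopologicalSpace H] (ζ : G →* H) (Λ : Cochain1 U G)
    (Ω : Cochain1 U H) : Prop :=
  ∀ (i j : J) (y : ↥(U i ⊓ U j)), ζ (Λ.val i j y) = Ω.val i j y

/-- The triple product `Λ i j · Λ j k · Λ k i`. -/
def triple [TopologicalSpace G] (Λ : Cochain1 U G) (i j k : J) (y : ↥(U i ⊓ U j ⊓ U k)) : G :=
  Λ.val i j ⟨y.1, y.2.1.1, y.2.1.2⟩ * Λ.val j k ⟨y.1, y.2.1.2, y.2.2⟩ *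
    Λ.val k i ⟨y.1, y.2.2, y.2.1.1⟩

/-- `f` is a closest point of `F` to `g`, where `F` carries the distance inherited from `G`. -/
def IsClosest [EMetricSpace G] (κ : F →* G) (g : G) (f : F) : Prop :=
  ∀ f' : F, edist g (κ f) ≤ edist g (κ f')

/-- The `2`-cochain `Γ` is obtained from `Λ` by rounding triple products to closest points
of `F`. -/
def IsRounding [EMetricSpace G] [TopologicalSpace F] (κ : F →* G) (Λ : Cochain1 U G)
    (Γ : Cochain2 U F) : Prop :=
  ∀ (i j k : J) (y : ↥(U i ⊓ U j ⊓ U k)), IsClosest κ (triple Λ i j k y) (Γ i j k y)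

/-- `del` is induced by the connecting construction: whenever `Λ` is a lift of an approximate
cocycle `Ω` and `Γ` is a `2`-cocycle obtained by rounding the triple products of `Λ`, the map `del`
sends the class of `Ω` to the class of `Γ`. -/
def IsConnectingMap [EMetricSpace G] [EMetricSpace H] [IsTopologicalGroup H] [TopologicalSpace F]
    [IsTopologicalGroup F] (κ : F →* G) (ζ : G →* H) {ε : ℝ≥0∞} (del : H1 U H ε → H2 U F) : Prop :=
  ∀ (Ω : Z1 U H ε) (Λ : Cochain1 U G) (Γ : Z2 U F),
    IsLift ζ Λ Ω.1 → IsRounding κ Λ Γ.1 → del (H1.mk Ω) = (Γ : H2 U F)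

end Connecting

end ApproxCech

/-! Since `ζ` is an open surjection with discrete kernel, it is a covering, and the pullback metric
makes it preserve lengths of paths. A path joining two distinct points of one fibre projects to a
loop of the same length that is not nullhomotopic, so distinct points of `F` are at least `s =
systole H` apart in `G` (`systole_le_edist_of_isCoveringMap`). Conversely short paths in `H` lift,
so elements of `G` with nearby images are close up to a factor in `F` (`exists_near_mul`).

Hence an approximate equation between elements of `F` is exact once its errors add up to at most
`s`. Biinvariance lets errors add under products, and centrality lets factors from `F` be moved
freely. A triple product of a lift is within `ε` of `F`; the cocycle identity follows from two
estimates of error `2ε` each (`exists_near_Z2`), and comparing lifts of two `δ`-close cochains costs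
`5δ` (`mk_eq_mk_of_near`). Both fit below `s` when `8ε` and `8δ` do. Independence of the lift,
invariance under `0`-cochains and stability all reduce to that comparison.

`IsMetricExtension` isolates what the geometry supplies; the rest is algebra with error bounds. -/

namespace ApproxCech

open scoped Topology

/-! ### Immersions and norm-preserving maps of manifolds -/

section Riemannian

open Manifold

variable {E : Type*} [NormedAddCommGroup E] [NormedSpace ℝ E]
  {M : Type*} [TopologicalSpace M] [ChartedSpace E M]
  {E' : Type*} [NormedAddCommGroup E'] [NormedSpace ℝ E']
  {N : Type*} [TopologicalSpace N] [ChartedSpace E' N]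

/-- A continuous path whose image under an immersion is `C¹` is itself `C¹`. -/
theorem contMDiffAt_of_comp_of_injective_mfderiv [FiniteDimensional ℝ E]
    [FiniteDimensional ℝ E'] [IsManifold 𝓘(ℝ, E) 1 M] [IsManifold 𝓘(ℝ, E') 1 N]
    {f : M → N} {σ : ℝ → M} {t : ℝ}
    (hf : ContMDiffAt 𝓘(ℝ, E) 𝓘(ℝ, E') 1 f (σ t))
    (hinj : Function.Injective (mfderiv 𝓘(ℝ, E) 𝓘(ℝ, E') f (σ t)))
    (hσ : ContinuousAt σ t) (hfσ : ContMDiffAt 𝓘(ℝ, ℝ) 𝓘(ℝ, E') 1 (f ∘ σ) t) :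
    ContMDiffAt 𝓘(ℝ, ℝ) 𝓘(ℝ, E) 1 σ t := by
  have : CompleteSpace E := FiniteDimensional.complete ℝ E
  set φ := extChartAt 𝓘(ℝ, E) (σ t) with hφ
  set ψ := extChartAt 𝓘(ℝ, E') (f (σ t)) with hψ
  set g : E → E' := ψ ∘ f ∘ φ.symm with hg
  have hgd : ContDiffAt ℝ 1 g (φ (σ t)) := by
    simpa [contDiffWithinAt_univ, hg, hφ, hψ] using (contMDiffAt_iff.1 hf).2
  have hfd : fderiv ℝ g (φ (σ t)) = mfderiv 𝓘(ℝ, E) 𝓘(ℝ, E') f (σ t) := by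
    rw [(hf.mdifferentiableAt one_ne_zero).mfderiv]
    simp [writtenInExtChartAt, hg, hφ, hψ]
  -- With `L` a left inverse of the derivative, `L ∘ g` has derivative the identity and so a `C¹`
  -- local inverse `inv`. Near `t` the path in the chart is `inv ∘ L ∘ ψ ∘ f ∘ σ`, and `f ∘ σ` is
  -- `C¹`.
  obtain ⟨L, hL⟩ := ContinuousLinearMap.HasLeftInverse.of_injective_of_finiteDimensional
    (f := fderiv ℝ g (φ (σ t))) (by rw [hfd]; exact hinj)
  have hLg : ContDiffAt ℝ 1 (L ∘ g) (φ (σ t)) := L.contDiff.contDiffAt.comp _ hgd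
  have hLg' : HasFDerivAt (L ∘ g) ((ContinuousLinearEquiv.refl ℝ E : E ≃L[ℝ] E) : E →L[ℝ] E)
      (φ (σ t)) := by
    have h := L.hasFDerivAt.comp (φ (σ t)) (hgd.differentiableAt one_ne_zero).hasFDerivAt
    convert h using 1
    ext v
    exact (hL v).symm
  set inv := hLg.localInverse hLg' one_ne_zero
  have hinv : ContDiffAt ℝ 1 inv ((L ∘ g) (φ (σ t))) := hLg.to_localInverse hLg' one_ne_zero
  have hleft : ∀ᶠ x in 𝓝 (φ (σ t)), inv ((L ∘ g) x) = x :=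
    (hLg.hasStrictFDerivAt' hLg' one_ne_zero).eventually_left_inverse
  have hsrc : ∀ᶠ u in 𝓝 t, σ u ∈ φ.source :=
    hσ.eventually (extChartAt_source_mem_nhds (I := 𝓘(ℝ, E)) (σ t))
  have hφσ : Filter.Tendsto (fun u => φ (σ u)) (𝓝 t) (𝓝 (φ (σ t))) :=
    (continuousAt_extChartAt (I := 𝓘(ℝ, E)) (σ t)).tendsto.comp hσ
  have hψfσ : ContMDiffAt 𝓘(ℝ, ℝ) 𝓘(ℝ, E') 1 (ψ ∘ f ∘ σ) t :=
    (contMDiffAt_iff_target.1 hfσ).2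
  have hgφ : g (φ (σ t)) = ψ (f (σ t)) := by simp [hg, hφ]
  rw [contMDiffAt_iff_target]
  refine ⟨hσ, ?_⟩
  have hcomp : ContDiffAt ℝ 1 (inv ∘ L ∘ ψ ∘ f ∘ σ) t := by
    refine ContDiffAt.comp t ?_ (L.contDiff.contDiffAt.comp _ hψfσ.contDiffAt)
    simpa [hgφ] using hinv
  refine (hcomp.congr_of_eventuallyEq ?_).contMDiffAt
  filter_upwards [hsrc, hφσ.eventually hleft] with u hu hlu
  simp only [Function.comp_apply, hg, φ.left_inv hu] at hlu
  exact hlu.symm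

variable [RiemannianBundle (fun x : M ↦ TangentSpace 𝓘(ℝ, E) x)]
  [RiemannianBundle (fun x : N ↦ TangentSpace 𝓘(ℝ, E') x)]

/-- The length of a path is preserved by a map whose derivative preserves norms. -/
theorem pathELength_comp_of_enorm_mfderiv {f : M → N} {γ : ℝ → M}
    (hf : MDifferentiable 𝓘(ℝ, E) 𝓘(ℝ, E') f)
    (hnorm : ∀ x (v : TangentSpace 𝓘(ℝ, E) x), ‖mfderiv 𝓘(ℝ, E) 𝓘(ℝ, E') f x v‖ₑ = ‖v‖ₑ)
    (hγ : MDifferentiable 𝓘(ℝ, ℝ) 𝓘(ℝ, E) γ) (a b : ℝ) :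
    pathELength 𝓘(ℝ, E') (f ∘ γ) a b = pathELength 𝓘(ℝ, E) γ a b := by
  simp only [pathELength_eq_lintegral_mfderiv_Icc]
  congr 1 with t
  rw [mfderiv_comp t (hf (γ t)) (hγ t)]
  exact hnorm _ _

/-- A `C¹` map whose derivative preserves norms does not increase distances. -/
theorem riemannianEDist_map_le {f : M → N} (hf : ContMDiff 𝓘(ℝ, E) 𝓘(ℝ, E') 1 f)
    (hnorm : ∀ x (v : TangentSpace 𝓘(ℝ, E) x), ‖mfderiv 𝓘(ℝ, E) 𝓘(ℝ, E') f x v‖ₑ = ‖v‖ₑ)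
    (x y : M) :
    riemannianEDist 𝓘(ℝ, E') (f x) (f y) ≤ riemannianEDist 𝓘(ℝ, E) x y := by
  refine le_of_forall_gt fun r hr => ?_
  -- This choice of path is `C¹` on all of `ℝ`, so no one-sided derivatives at the endpoints arise.
  obtain ⟨γ, h0, h1, hγ, hlt, -⟩ :=
    exists_lt_locally_constant_of_riemannianEDist_lt hr zero_lt_one
  refine lt_of_le_of_lt ?_ hlt
  rw [← pathELength_comp_of_enorm_mfderiv (hf.mdifferentiable one_ne_zero) hnorm
    (hγ.mdifferentiable one_ne_zero)]
  exact riemannianEDist_le_pathELength (hf.comp hγ).contMDiffOn (by simp [h0]) (by simp [h1])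
    zero_le_one

theorem enorm_eq_enorm_of_inner_eq {V W : Type*} [NormedAddCommGroup V] [InnerProductSpace ℝ V]
    [NormedAddCommGroup W] [InnerProductSpace ℝ W] {v : V} {w : W}
    (h : inner ℝ v v = inner ℝ w w) : ‖v‖ₑ = ‖w‖ₑ := by
  rw [← ofReal_norm, ← ofReal_norm, norm_eq_sqrt_real_inner, norm_eq_sqrt_real_inner, h]

end Riemannian

/-! ### Lengths, coverings and the systole -/

section Length

open Manifold

variable {E : Type*} [NormedAddCommGroup E] [NormedSpace ℝ E]
  {M : Type*} [EMetricSpace M] [ChartedSpace E M]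
  [RiemannianBundle (fun x : M ↦ TangentSpace 𝓘(ℝ, E) x)] [IsRiemannianManifold 𝓘(ℝ, E) M]

/-- Each chord of a partition is at most the length of the arc it spans, and arc lengths add. -/
theorem eVariationOn_le_pathELength {γ : ℝ → M} (hγ : ContMDiff 𝓘(ℝ, ℝ) 𝓘(ℝ, E) 1 γ) :
    eVariationOn (fun t : unitInterval => γ t) Set.univ ≤ pathELength 𝓘(ℝ, E) γ 0 1 := by
  refine iSup_le fun ⟨n, u, hu, _⟩ => ?_
  have key : ∀ m, ∑ i ∈ Finset.range m, edist (γ (u (i + 1))) (γ (u i)) ≤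
      pathELength 𝓘(ℝ, E) γ (u 0) (u m) := by
    intro m
    induction m with
    | zero => simp
    | succ m ih =>
      rw [Finset.sum_range_succ, ← pathELength_add (b := ((u m : unitInterval) : ℝ))
        (hu (Nat.zero_le m)) (hu (Nat.le_succ m))]
      refine add_le_add ih ?_
      rw [edist_comm, IsRiemannianManifold.out (I := 𝓘(ℝ, E))]
      exact riemannianEDist_le_pathELength hγ.contMDiffOn rfl rfl (hu (Nat.le_succ m))
  exact (key n).trans (pathELength_mono (u 0).2.1 (u n).2.2)

variable {E' : Type*} [NormedAddCommGroup E'] [NormedSpace ℝ E']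
  {N : Type*} [EMetricSpace N] [ChartedSpace E' N]
  [RiemannianBundle (fun x : N ↦ TangentSpace 𝓘(ℝ, E') x)] [IsRiemannianManifold 𝓘(ℝ, E') N]

theorem edist_map_le {f : M → N} (hf : ContMDiff 𝓘(ℝ, E) 𝓘(ℝ, E') 1 f)
    (hnorm : ∀ x (v : TangentSpace 𝓘(ℝ, E) x), ‖mfderiv 𝓘(ℝ, E) 𝓘(ℝ, E') f x v‖ₑ = ‖v‖ₑ)
    (x y : M) : edist (f x) (f y) ≤ edist x y := by
  rw [IsRiemannianManifold.out (I := 𝓘(ℝ, E)) x y, IsRiemannianManifold.out (I := 𝓘(ℝ, E')) (f x)]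
  exact riemannianEDist_map_le hf hnorm x y

/-- A covering map whose derivative preserves norms lifts short paths to paths of the same
length. -/
theorem exists_edist_lt_of_isCoveringMap [FiniteDimensional ℝ E] [FiniteDimensional ℝ E']
    [IsManifold 𝓘(ℝ, E) 1 M] [IsManifold 𝓘(ℝ, E') 1 N]
    {p : M → N} (hcov : IsCoveringMap p) (hp : ContMDiff 𝓘(ℝ, E) 𝓘(ℝ, E') 1 p)
    (hnorm : ∀ x (v : TangentSpace 𝓘(ℝ, E) x), ‖mfderiv 𝓘(ℝ, E) 𝓘(ℝ, E') p x v‖ₑ = ‖v‖ₑ)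
    {x : M} {y : N} {r : ℝ≥0∞} (h : edist (p x) y < r) : ∃ x', p x' = y ∧ edist x x' < r := by
  rw [IsRiemannianManifold.out (I := 𝓘(ℝ, E'))] at h
  obtain ⟨γ, h0, h1, hγ, hlt, -⟩ :=
    exists_lt_locally_constant_of_riemannianEDist_lt h zero_lt_one
  obtain ⟨σ, ⟨hσ0, hσ⟩, -⟩ := hcov.existsUnique_continuousMap_lifts ⟨γ, hγ.continuous⟩ 0 x h0.symm
  have hσ : p ∘ σ = γ := hσ
  have hsm : ContMDiff 𝓘(ℝ, ℝ) 𝓘(ℝ, E) 1 σ := fun t => by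
    refine contMDiffAt_of_comp_of_injective_mfderiv (hp _) ?_ σ.continuous.continuousAt
      (by rw [hσ]; exact hγ t)
    -- A norm-preserving derivative has trivial kernel, so `p` is an immersion and the continuous
    -- lift is `C¹`.
    refine (injective_iff_map_eq_zero _).2 fun v hv => ?_
    have := hnorm _ v
    rw [hv, enorm_zero] at this
    exact enorm_eq_zero.1 this.symm
  refine ⟨σ 1, (congrFun hσ 1).trans h1, lt_of_le_of_lt ?_ hlt⟩
  rw [← hσ, pathELength_comp_of_enorm_mfderiv (hp.mdifferentiable one_ne_zero) hnorm
    (hsm.mdifferentiable one_ne_zero), IsRiemannianManifold.out (I := 𝓘(ℝ, E))]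
  exact riemannianEDist_le_pathELength hsm.contMDiffOn hσ0 rfl zero_le_one

/-- Distinct points in a fibre of a covering map whose derivative preserves norms are at least
a systole apart. -/
theorem systole_le_edist_of_isCoveringMap {p : M → N} (hcov : IsCoveringMap p)
    (hp : ContMDiff 𝓘(ℝ, E) 𝓘(ℝ, E') 1 p)
    (hnorm : ∀ x (v : TangentSpace 𝓘(ℝ, E) x), ‖mfderiv 𝓘(ℝ, E) 𝓘(ℝ, E') p x v‖ₑ = ‖v‖ₑ)
    {x y : M} (hxy : p x = p y) (hne : x ≠ y) : systole N ≤ edist x y := by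
  rw [IsRiemannianManifold.out (I := 𝓘(ℝ, E))]
  refine le_of_forall_gt fun r hr => ?_
  obtain ⟨γ, h0, h1, hγ, hlt, -⟩ :=
    exists_lt_locally_constant_of_riemannianEDist_lt hr zero_lt_one
  refine lt_of_le_of_lt ?_ hlt
  rw [← pathELength_comp_of_enorm_mfderiv (hp.mdifferentiable one_ne_zero) hnorm
    (hγ.mdifferentiable one_ne_zero)]
  refine le_trans ?_ (eVariationOn_le_pathELength (hp.comp hγ))
  let δ : C(unitInterval, M) := ⟨fun t => γ t, hγ.continuous.comp continuous_subtype_val⟩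
  let c : Path (p x) (p x) := ⟨⟨fun t => p (γ t), hcov.continuous.comp δ.continuous⟩,
    by simp [h0], by simp [h1, hxy]⟩
  refine iInf₂_le_of_le (p x) c (iInf_le_of_le (fun hc => hne ?_) le_rfl)
  -- If the projected loop were nullhomotopic, its lift `δ` from `x` would end where the constant
  -- lift ends, forcing `y = x`.
  have h := hcov.liftPath_apply_one_eq_of_homotopicRel hc x (by simp) (by simp)
  rw [← (hcov.eq_liftPath_iff' (Γ := δ) (γ := c.toContinuousMap) (by simp)).2
      ⟨rfl, by simp [δ, h0]⟩,
    ← (hcov.eq_liftPath_iff' (e := x) (Γ := ContinuousMap.const unitInterval x)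
      (γ := (Path.refl (p x)).toContinuousMap) (by simp)).2 ⟨rfl, rfl⟩] at h
  simpa [δ, h1] using h.symm

end Length

/-! ### Error calculus in groups with biinvariant distance -/

section Near

variable {X : Type*} [EMetricSpace X]

/-- Two points are equal or at distance less than `r`. -/
def Near (r : ℝ≥0∞) (a b : X) : Prop := a = b ∨ edist a b < r

theorem near_iff_edist_lt {r : ℝ≥0∞} (hr : r ≠ 0) {a b : X} : Near r a b ↔ edist a b < r :=
  ⟨fun h => h.elim (fun h => by rw [h, edist_self]; exact hr.bot_lt) id, Or.inr⟩

theorem near_zero_iff {a b : X} : Near 0 a b ↔ a = b := by simp [Near]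

theorem Near.mono {r s : ℝ≥0∞} {a b : X} (h : Near r a b) (hrs : r ≤ s) : Near s a b :=
  h.imp_right fun h => h.trans_le hrs

theorem Near.symm {r : ℝ≥0∞} {a b : X} (h : Near r a b) : Near r b a :=
  h.imp Eq.symm fun h => by rwa [edist_comm]

/-- Errors add even when one of them is `0`, where `Near` means equality; exact and approximate
cocycles thus share one argument. -/
theorem Near.trans {r s : ℝ≥0∞} {a b c : X} (h : Near r a b) (h' : Near s b c) :
    Near (r + s) a c := by
  rcases h with rfl | h
  · exact h'.mono le_add_self
  rcases h' with rfl | h'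
  · exact Near.mono (.inr h) le_self_add
  · exact .inr ((edist_triangle a b c).trans_lt (ENNReal.add_lt_add h h'))

variable {G : Type*} [EMetricSpace G] [Group G]

theorem Near.mul_left [IsIsometricSMul G G] {r : ℝ≥0∞} {a b : G} (h : Near r a b) (c : G) :
    Near r (c * a) (c * b) :=
  h.imp (congrArg _) fun h => by rwa [edist_mul_left]

theorem Near.mul_right [IsIsometricSMul Gᵐᵒᵖ G] {r : ℝ≥0∞} {a b : G} (h : Near r a b) (c : G) :
    Near r (a * c) (b * c) :=
  h.imp (congrArg (· * c)) fun h => by rwa [edist_mul_right]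

variable [IsIsometricSMul G G] [IsIsometricSMul Gᵐᵒᵖ G]

theorem Near.mul {r s : ℝ≥0∞} {a b c d : G} (h : Near r a b) (h' : Near s c d) :
    Near (r + s) (a * c) (b * d) :=
  (h.mul_right c).trans (h'.mul_left b)

theorem Near.inv {r : ℝ≥0∞} {a b : G} (h : Near r a b) : Near r a⁻¹ b⁻¹ :=
  h.imp (congrArg _) fun h => by rwa [edist_inv_inv]

end Near

/-- The metric properties of a central extension of groups with biinvariant distances on which
the rounding construction relies: `κ` embeds a discrete group as the kernel of the covering
homomorphism `ζ`, points of `F` are `s` apart, and `ζ` lifts distances. -/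
structure IsMetricExtension {F G H : Type*} [CommGroup F] [TopologicalSpace F] [EMetricSpace G]
    [Group G] [EMetricSpace H] [Group H] (κ : F →* G) (ζ : G →* H) (s : ℝ≥0∞) : Prop where
  isEmbedding : Topology.IsEmbedding κ
  central : ∀ f, κ f ∈ Subgroup.center G
  exact : κ.range = ζ.ker
  surjective : Function.Surjective ζ
  isCoveringMap : IsCoveringMap ζ
  le_edist : ∀ f f', f ≠ f' → s ≤ edist (κ f) (κ f')
  lift_edist : ∀ (g : G) (h : H) (r : ℝ≥0∞), edist (ζ g) h < r → ∃ g', ζ g' = h ∧ edist g g' < r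

/-! ### Rounding to the discrete central subgroup -/

namespace IsMetricExtension

variable {F G H : Type*} [CommGroup F] [TopologicalSpace F] [EMetricSpace G]
  [Group G] [EMetricSpace H] [Group H] {κ : F →* G} {ζ : G →* H} {s : ℝ≥0∞}
  (hκ : IsMetricExtension κ ζ s)

include hκ

theorem comm (f : F) (g : G) : g * κ f = κ f * g := Subgroup.mem_center_iff.1 (hκ.central f) g

theorem map_map (f : F) : ζ (κ f) = 1 := by
  have : κ f ∈ ζ.ker := hκ.exact ▸ ⟨f, rfl⟩
  exact this

theorem exists_mul_eq {g g' : G} (h : ζ g = ζ g') : ∃ f, g = g' * κ f := by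
  have : g'⁻¹ * g ∈ κ.range := by rw [hκ.exact, MonoidHom.mem_ker, map_mul, map_inv, h]; simp
  obtain ⟨f, hf⟩ := this
  exact ⟨f, by simp [hf]⟩

/-- A point over `ζ g'` close to `g` exists by lifting distances, and it differs from `g'` by an
element of `F`. -/
theorem exists_near_mul {r : ℝ≥0∞} {g g' : G} (h : Near r (ζ g) (ζ g')) :
    ∃ f, Near r g (g' * κ f) := by
  rcases h with h | h
  · obtain ⟨f, hf⟩ := hκ.exists_mul_eq h
    exact ⟨f, .inl hf⟩
  · obtain ⟨x, hx, hgx⟩ := hκ.lift_edist g _ r h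
    obtain ⟨f, rfl⟩ := hκ.exists_mul_eq hx
    exact ⟨f, .inr hgx⟩

theorem eq_of_near {r : ℝ≥0∞} {f f' : F} (h : Near r (κ f) (κ f')) (hr : r ≤ s) : f = f' := by
  by_contra hne
  rcases h with h | h
  · exact hne (hκ.isEmbedding.injective h)
  · exact (h.trans_le hr).not_ge (hκ.le_edist f f' hne)

theorem eq_of_near_near {r r' : ℝ≥0∞} {g : G} {f f' : F} (h : Near r g (κ f))
    (h' : Near r' g (κ f')) (hr : r + r' ≤ s) : f = f' :=
  hκ.eq_of_near (h.symm.trans h') hr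

/-- A point of `F` at least as close to `g` as `f` also satisfies the bound `r`, and the separation
of `F` leaves room for only one such point. Existence of a minimum comes for free. -/
theorem isClosest_iff {r : ℝ≥0∞} {g : G} {f f' : F} (h : Near r g (κ f)) (hr : r + r ≤ s) :
    IsClosest κ g f' ↔ f' = f := by
  constructor
  · intro hf'
    have : Near r g (κ f') := by
      rcases h with h | h
      · left
        simpa [h] using hf' f
      · exact .inr ((hf' f).trans_lt h)
    exact hκ.eq_of_near_near this h hr
  · rintro rfl f''
    by_contra! hlt
    have : Near r g (κ f'') := by
      rcases h with h | h
      · simp [h] at hlt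
      · exact .inr (hlt.trans h)
    rw [hκ.eq_of_near_near this h hr] at hlt
    exact hlt.false

/-- Rounding a continuous map to nearby points of the discrete group is continuous. -/
theorem continuous_of_near {X : Type*} [TopologicalSpace X] {r : ℝ≥0∞} (hr : r + r ≤ s)
    {u : X → G} (hu : Continuous u) {f : X → F} (h : ∀ x, Near r (u x) (κ (f x))) :
    Continuous f := by
  -- For `r = 0` the map `κ ∘ f` is `u` itself. Otherwise `f x` stays within `r` of `u y` for `y`
  -- near `x`, so uniqueness makes `f` locally constant.
  rcases eq_or_ne r 0 with rfl | hr0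
  · rw [hκ.isEmbedding.continuous_iff]
    convert hu with x
    ext x
    exact (near_zero_iff.1 (h x)).symm
  · refine continuous_iff_continuousAt.2 fun x => ?_
    have hx : ∀ᶠ y in 𝓝 x, edist (u y) (κ (f x)) < r :=
      ((hu.edist continuous_const).tendsto x).eventually_lt_const
        ((near_iff_edist_lt hr0).1 (h x))
    refine (continuousAt_const (y := f x)).congr ?_
    filter_upwards [hx] with y hy
    exact hκ.eq_of_near_near (.inr hy) (h y) hr

/-- Nearby lifts can be rounded to a continuous family of deck transformations. -/
theorem exists_continuousMap_near [IsTopologicalGroup G] [IsIsometricSMul G G]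
    {X : Type*} [TopologicalSpace X] {r : ℝ≥0∞}
    (hr : r + r ≤ s) (u v : C(X, G)) (h : ∀ x, Near r (ζ (u x)) (ζ (v x))) :
    ∃ f : C(X, F), ∀ x, Near r (u x) (v x * κ (f x)) := by
  choose f hf using fun x => hκ.exists_near_mul (h x)
  refine ⟨⟨f, hκ.continuous_of_near hr (u := fun x => (v x)⁻¹ * u x) (by fun_prop) fun x => ?_⟩, hf⟩
  exact (hf x).imp (fun h => by simp [h]) fun h => by
    rwa [← edist_mul_left (v x), mul_inv_cancel_left]

/-- The lifting criterion for coverings of simply connected, locally path connected spaces; the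
empty space is separate because the topological hypotheses concern nonempty sets only. -/
theorem exists_continuousMap_lift {X : Type*} [TopologicalSpace X]
    (hX : Nonempty X → LocallyPathConnectedSpace X ∧ SimplyConnectedSpace X) (w : C(X, H)) :
    ∃ u : C(X, G), ∀ x, ζ (u x) = w x := by
  rcases isEmpty_or_nonempty X with h | h
  · exact ⟨⟨fun x => isEmptyElim x, by fun_prop⟩, fun x => isEmptyElim x⟩
  obtain ⟨_, _⟩ := hX h
  obtain ⟨x₀⟩ := h
  obtain ⟨g, hg⟩ := hκ.surjective (w x₀)
  obtain ⟨u, ⟨-, hu⟩, -⟩ := hκ.isCoveringMap.existsUnique_continuousMap_lifts w x₀ g hg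
  exact ⟨u, congrFun hu⟩

end IsMetricExtension

/-! ### Lifting and rounding Čech cochains -/

section Cochains

variable {G : Type*} [EMetricSpace G] [Group G] {B : Type*} [TopologicalSpace B] {J : Type*}
  {U : J → Opens B}

theorem IsApproxCocycle.near {ε : ℝ≥0∞} {Ω : Cochain1 U G}
    (hΩ : IsApproxCocycle ε Ω) (i j k : J) (y : B) (hi : y ∈ U i) (hj : y ∈ U j) (hk : y ∈ U k) :
    Near ε (Ω.val i j ⟨y, hi, hj⟩ * Ω.val j k ⟨y, hj, hk⟩) (Ω.val i k ⟨y, hi, hk⟩) := by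
  rcases eq_or_ne ε 0 with h | h
  · exact .inl ((hΩ i j k y hi hj hk).1 h)
  · exact .inr ((hΩ i j k y hi hj hk).2 h)

/-- The exchange of the two members of an intersection. -/
def interSwap (U : J → Opens B) (i j : J) : C(↥(U i ⊓ U j), ↥(U j ⊓ U i)) :=
  ⟨fun y => ⟨y.1, y.2.2, y.2.1⟩, by fun_prop⟩

theorem continuous_triple [IsTopologicalGroup G] (Λ : Cochain1 U G) (i j k : J) :
    Continuous (triple Λ i j k) := by
  unfold triple
  fun_prop

end Cochains

namespace IsMetricExtension

variable {F G H : Type*} [CommGroup F] [TopologicalSpace F] [EMetricSpace G]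
  [Group G] [EMetricSpace H] [Group H] {κ : F →* G} {ζ : G →* H} {s : ℝ≥0∞}
  {B : Type*} [TopologicalSpace B] {J : Type*} {U : J → Opens B}

variable (hκ : IsMetricExtension κ ζ s) {ε δ : ℝ≥0∞}

include hκ

/-- Replaces minimality by an error bound, which behaves well under products. -/
theorem isRounding_iff (hε : ε + ε ≤ s) {Λ : Cochain1 U G}
    {Γ : Cochain2 U F} (hex : ∀ i j k y, ∃ f, Near ε (triple Λ i j k y) (κ f)) :
    IsRounding κ Λ Γ ↔ ∀ i j k y, Near ε (triple Λ i j k y) (κ (Γ i j k y)) := by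
  refine ⟨fun h i j k y => ?_, fun h i j k y => (hκ.isClosest_iff (h i j k y) hε).2 rfl⟩
  obtain ⟨f, hf⟩ := hex i j k y
  rwa [(hκ.isClosest_iff hf hε).1 (h i j k y)]

/-- `Λ i j * Λ j k` is `ε`-close to `Λ i k` times an element of `F`; multiplying by `Λ k i` leaves
that element. -/
theorem exists_near_triple [IsIsometricSMul Gᵐᵒᵖ G] {Ω : Cochain1 U H} (hΩ : IsApproxCocycle ε Ω)
    {Λ : Cochain1 U G} (hΛ : IsLift ζ Λ Ω) (i j k : J) (y : ↥(U i ⊓ U j ⊓ U k)) :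
    ∃ f, Near ε (triple Λ i j k y) (κ f) := by
  obtain ⟨y, ⟨hi, hj⟩, hk⟩ := y
  obtain ⟨f, hf⟩ := hκ.exists_near_mul (r := ε)
    (g := Λ.val i j ⟨y, hi, hj⟩ * Λ.val j k ⟨y, hj, hk⟩) (g' := Λ.val i k ⟨y, hi, hk⟩) (by
      rw [map_mul, hΛ, hΛ, hΛ]
      exact hΩ.near i j k y hi hj hk)
  refine ⟨f, ?_⟩
  have h := hf.mul_right (Λ.val k i ⟨y, hk, hi⟩)
  rw [hκ.comm, mul_assoc (κ f), Λ.symm i k y hi hk, inv_mul_cancel, mul_one] at h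
  exact h

variable [IsTopologicalGroup G] [IsIsometricSMul G G] [IsIsometricSMul Gᵐᵒᵖ G]

/-- Symmetry on the diagonal demands a lift squaring to `1`. For any lift `v`, the square `v * v` is
near `v * κ f`, because `Ω i i` squared is near `Ω i i`. So `v * (κ f)⁻¹` is `ε`-close to `1`; its
square lies in the kernel within `2ε` of `1`, hence equals `1`. -/
theorem exists_involutive_lift (hU : IsGoodFamily U) {Ω : Cochain1 U H}
    (hΩ : IsApproxCocycle ε Ω) (hε : ε + ε ≤ s) (i : J) :
    ∃ u : C(↥(U i ⊓ U i), G), (∀ y, ζ (u y) = Ω.val i i y) ∧ ∀ y, u y * u y = 1 := by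
  obtain ⟨v, hv⟩ := hκ.exists_continuousMap_lift (hU.inter i i) (Ω.val i i)
  obtain ⟨f, hf⟩ := hκ.exists_continuousMap_near hε (v * v) v fun y => by
    rw [ContinuousMap.mul_apply, map_mul, hv]
    exact hΩ.near i i i y.1 y.2.1 y.2.1 y.2.1
  have hκc : Continuous κ := hκ.isEmbedding.continuous
  refine ⟨⟨fun y => v y * (κ (f y))⁻¹, by fun_prop⟩, fun y => ?_, fun y => ?_⟩
  · simp [hv, hκ.map_map]
  · have hsq : ζ ((v y * (κ (f y))⁻¹) * (v y * (κ (f y))⁻¹)) = ζ 1 := by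
      simp only [map_mul, map_inv, hκ.map_map, hv, map_one, inv_one, mul_one]
      exact eq_inv_iff_mul_eq_one.1 (Ω.symm i i y.1 y.2.1 y.2.1)
    have hnear : Near ε (v y * (κ (f y))⁻¹) 1 := by
      have h := ((hf y).mul_left (v y)⁻¹).mul_right (κ (f y))⁻¹
      simpa [mul_assoc] using h
    obtain ⟨f', hf'⟩ := hκ.exists_mul_eq hsq
    have h := hnear.mul hnear
    rw [hf', one_mul, one_mul, ← map_one κ] at h
    have : f' = 1 := hκ.eq_of_near h hε
    simpa [this] using hf'

/-- Approximate cocycles lift to symmetric cochains. -/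
theorem exists_isLift (hU : IsGoodFamily U) {Ω : Cochain1 U H}
    (hΩ : IsApproxCocycle ε Ω) (hε : ε + ε ≤ s) : ∃ Λ : Cochain1 U G, IsLift ζ Λ Ω := by
  classical
  have hex : ∀ i j, ∃ u : C(↥(U i ⊓ U j), G), (∀ y, ζ (u y) = Ω.val i j y) ∧
      (i = j → ∀ y, u y * u y = 1) := by
    intro i j
    rcases eq_or_ne i j with rfl | hij
    · obtain ⟨u, hu, hu'⟩ := hκ.exists_involutive_lift hU hΩ hε i
      exact ⟨u, hu, fun _ => hu'⟩
    · obtain ⟨u, hu⟩ := hκ.exists_continuousMap_lift (hU.inter i j) (Ω.val i j)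
      exact ⟨u, hu, fun h => absurd h hij⟩
  choose L hL hL' using hex
  -- An arbitrary order selects one lift per unordered pair, the other being its inverse; the
  -- involutive lifts make the diagonal consistent.
  let _ : LinearOrder J := linearOrderOfSTO WellOrderingRel
  refine ⟨⟨fun i j => if i ≤ j then L i j else ((L j i).comp (interSwap U i j))⁻¹,
    fun i j y hi hj => ?_⟩, fun i j y => ?_⟩
  · rcases lt_trichotomy i j with h | rfl | h
    · simp [h.le, h.not_ge, interSwap]
    · simpa using eq_inv_of_mul_eq_one_left (hL' i i rfl ⟨y, hi, hj⟩)
    · simp [h.le, h.not_ge, interSwap]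
  · by_cases h : i ≤ j
    · simp [h, hL]
    · simp only [h, if_false, ContinuousMap.inv_apply, ContinuousMap.comp_apply, map_inv, hL]
      exact (Ω.symm i j y.1 y.2.1 y.2.2).symm

/-- The triple products of a lift of an approximate cocycle round to a `2`-cocycle. -/
theorem exists_near_Z2 [IsTopologicalGroup F] {Ω : Cochain1 U H} (hΩ : IsApproxCocycle ε Ω)
    (hε : 8 * ε ≤ s) {Λ : Cochain1 U G} (hΛ : IsLift ζ Λ Ω) :
    ∃ Γ : Z2 U F, ∀ i j k y, Near ε (triple Λ i j k y) (κ (Γ.1 i j k y)) := by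
  choose f hf using fun i j k y => hκ.exists_near_triple hΩ hΛ i j k y
  have h2 : ε + ε ≤ s := le_trans (by rw [← two_mul]; gcongr; norm_num) hε
  have h4 : (ε + ε) + (ε + ε) ≤ s :=
    le_trans (by rw [← two_mul, ← two_mul, ← mul_assoc]; gcongr; norm_num) hε
  refine ⟨⟨fun i j k => ⟨f i j k, hκ.continuous_of_near h2 (continuous_triple Λ i j k)
    (hf i j k)⟩, fun i j k l y hi hj hk hl => ?_⟩, hf⟩
  simp only [ContinuousMap.coe_mk]
  -- By `heq`, `e₁` and `e₂` round the same element of `G`, each with error `2ε`. Conjugation by `Λ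
  -- i j` does not move central elements.
  have e₁ := (hf i j k ⟨y, ⟨hi, hj⟩, hk⟩).mul (hf i k l ⟨y, ⟨hi, hk⟩, hl⟩)
  have e₂ := (((hf j k l ⟨y, ⟨hj, hk⟩, hl⟩).mul_left (Λ.val i j ⟨y, hi, hj⟩)).mul_right
    (Λ.val i j ⟨y, hi, hj⟩)⁻¹).mul (hf i j l ⟨y, ⟨hi, hj⟩, hl⟩)
  rw [hκ.comm _ (Λ.val i j _), mul_inv_cancel_right, ← map_mul] at e₂
  rw [← map_mul] at e₁
  have heq : triple Λ i j k ⟨y, ⟨hi, hj⟩, hk⟩ * triple Λ i k l ⟨y, ⟨hi, hk⟩, hl⟩ =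
      Λ.val i j ⟨y, hi, hj⟩ * triple Λ j k l ⟨y, ⟨hj, hk⟩, hl⟩ * (Λ.val i j ⟨y, hi, hj⟩)⁻¹ *
        triple Λ i j l ⟨y, ⟨hi, hj⟩, hl⟩ := by
    simp only [triple]
    rw [Λ.symm k i y hk hi, Λ.symm l j y hl hj]
    group
  rw [heq] at e₁
  have h := hκ.eq_of_near_near e₁ e₂ h4
  rw [mul_right_comm (f i j k _) _ (f i k l _), h, mul_inv_cancel_right, mul_inv_cancel]

/-- Lifts of nearby cochains round to cohomologous `2`-cocycles. -/
theorem mk_eq_mk_of_near [IsTopologicalGroup F] (hδ : 8 * δ ≤ s) {Λ Λ' : Cochain1 U G}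
    (h : ∀ i j y, Near δ (ζ (Λ'.val i j y)) (ζ (Λ.val i j y))) {Γ Γ' : Z2 U F}
    (hΓ : ∀ i j k y, Near δ (triple Λ i j k y) (κ (Γ.1 i j k y)))
    (hΓ' : ∀ i j k y, Near δ (triple Λ' i j k y) (κ (Γ'.1 i j k y))) :
    (Γ : H2 U F) = (Γ' : H2 U F) := by
  have h2 : δ + δ ≤ s := le_trans (by rw [← two_mul]; gcongr; norm_num) hδ
  -- Three errors come from the factors `f`, one from `Γ` and one from `Γ'`.
  have h5 : δ + (δ + δ + δ + δ) ≤ s := by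
    refine le_trans ?_ hδ
    calc δ + (δ + δ + δ + δ) = 5 * δ := by ring
      _ ≤ 8 * δ := by gcongr; norm_num
  choose f hf using fun i j => hκ.exists_continuousMap_near h2 (Λ'.val i j) (Λ.val i j) (h i j)
  -- `f i j` and `(f j i)⁻¹` both round `(Λ i j)⁻¹ * Λ' i j`, so they agree.
  let Φ : Cochain1 U F := ⟨f, fun i j y hi hj => by
    have e₁ := (hf i j ⟨y, hi, hj⟩).mul_left (Λ.val i j ⟨y, hi, hj⟩)⁻¹
    have e₂ := (hf j i ⟨y, hj, hi⟩).inv.mul_left (Λ.val i j ⟨y, hi, hj⟩)⁻¹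
    rw [inv_mul_cancel_left] at e₁
    rw [← Λ'.symm i j y hi hj, hκ.comm, mul_inv_rev, ← Λ.symm i j y hi hj, inv_mul_cancel_left,
      ← map_inv κ] at e₂
    exact hκ.eq_of_near_near e₁ e₂ h2⟩
  refine QuotientGroup.eq.2 (Subgroup.mem_subgroupOf.2 ⟨Φ, fun i j k y hi hj hk => ?_⟩)
  have e := ((hf i j ⟨y, hi, hj⟩).mul (hf j k ⟨y, hj, hk⟩)).mul (hf k i ⟨y, hk, hi⟩)
  have heq : Λ.val i j ⟨y, hi, hj⟩ * κ (f i j ⟨y, hi, hj⟩) *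
      (Λ.val j k ⟨y, hj, hk⟩ * κ (f j k ⟨y, hj, hk⟩)) *
      (Λ.val k i ⟨y, hk, hi⟩ * κ (f k i ⟨y, hk, hi⟩)) =
      triple Λ i j k ⟨y, ⟨hi, hj⟩, hk⟩ *
        κ (f i j ⟨y, hi, hj⟩ * f j k ⟨y, hj, hk⟩ * f k i ⟨y, hk, hi⟩) := by
    simp only [triple, map_mul, mul_assoc]
    rw [← mul_assoc (κ _) (Λ.val j k _), ← hκ.comm]
    simp only [mul_assoc]
    congr 2
    rw [← mul_assoc (κ _) (κ _), ← map_mul, ← mul_assoc (κ _) (Λ.val k i _), ← hκ.comm]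
    simp only [mul_assoc, map_mul]
  rw [heq] at e
  have e' := e.trans ((hΓ i j k ⟨y, ⟨hi, hj⟩, hk⟩).mul_right _)
  rw [← map_mul] at e'
  have := hκ.eq_of_near_near (hΓ' i j k ⟨y, ⟨hi, hj⟩, hk⟩) e' h5
  change (Γ.1 i j k _)⁻¹ * Γ'.1 i j k _ = _
  rw [this, inv_mul_cancel_left]

/-- The rounding of a lift is determined up to coboundaries by the class of the cocycle. -/
theorem mk_eq_mk_of_isTranslate [IsTopologicalGroup F] (hU : IsGoodFamily U) (hδ : 8 * δ ≤ s)
    {Ω Ω' : Cochain1 U H} {Θ : Cochain0 U H} (hΘ : IsTranslate Θ Ω Ω')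
    {Λ Λ' : Cochain1 U G} (hΛ : IsLift ζ Λ Ω) (hΛ' : IsLift ζ Λ' Ω') {Γ Γ' : Z2 U F}
    (hΓ : ∀ i j k y, Near δ (triple Λ i j k y) (κ (Γ.1 i j k y)))
    (hΓ' : ∀ i j k y, Near δ (triple Λ' i j k y) (κ (Γ'.1 i j k y))) :
    (Γ : H2 U F) = (Γ' : H2 U F) := by
  choose T hT using fun i => hκ.exists_continuousMap_lift (hU.single i) (Θ i)
  -- `M` lifts `Ω'`, and its triple products are conjugates of those of `Λ`, so they round to the
  -- same central elements `Γ`.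
  let M : Cochain1 U G := ⟨fun i j => ⟨fun y => T i ⟨y.1, y.2.1⟩ * Λ.val i j y *
    (T j ⟨y.1, y.2.2⟩)⁻¹, by fun_prop⟩, fun i j y hi hj => by
      simp only [ContinuousMap.coe_mk, Λ.symm i j y hi hj]
      group⟩
  refine hκ.mk_eq_mk_of_near hδ (Λ := M) (Λ' := Λ') (fun i j y => .inl ?_) (fun i j k y => ?_) hΓ'
  · rw [hΛ' i j y, hΘ i j y.1 y.2.1 y.2.2]
    simp only [M, ContinuousMap.coe_mk, map_mul, map_inv, hT, hΛ i j y]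
  · have h := ((hΓ i j k y).mul_left (T i ⟨y.1, y.2.1.1⟩)).mul_right (T i ⟨y.1, y.2.1.1⟩)⁻¹
    rw [hκ.comm, mul_inv_cancel_right] at h
    convert h using 1
    simp only [triple, M, ContinuousMap.coe_mk]
    group

/-! ### The connecting map -/

variable [IsTopologicalGroup F]

theorem exists_isLift_near (hU : IsGoodFamily U) (hε : 8 * ε ≤ s) (Ω : Z1 U H ε) :
    ∃ (Λ : Cochain1 U G) (Γ : Z2 U F), IsLift ζ Λ Ω.1 ∧
      ∀ i j k y, Near ε (triple Λ i j k y) (κ (Γ.1 i j k y)) := by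
  have h2 : ε + ε ≤ s := le_trans (by rw [← two_mul]; gcongr; norm_num) hε
  obtain ⟨Λ, hΛ⟩ := hκ.exists_isLift hU Ω.2 h2
  obtain ⟨Γ, hΓ⟩ := hκ.exists_near_Z2 Ω.2 hε hΛ
  exact ⟨Λ, Γ, hΛ, hΓ⟩

variable [IsTopologicalGroup H]

theorem existsUnique_isConnectingMap (hU : IsGoodFamily U) (hε : 8 * ε ≤ s) :
    ∃! del : H1 U H ε → H2 U F, IsConnectingMap κ ζ del := by
  have h2 : ε + ε ≤ s := le_trans (by rw [← two_mul]; gcongr; norm_num) hε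
  choose Λ Γ hΛ hΓ using hκ.exists_isLift_near (F := F) hU hε
  refine ⟨Quotient.lift (fun Ω => (Γ Ω : H2 U F)) ?_, fun Ω Λ' Γ' hΛ' hΓ' => ?_,
    fun del hdel => ?_⟩
  · rintro Ω Ω' ⟨Θ, hΘ⟩
    exact hκ.mk_eq_mk_of_isTranslate hU hε hΘ (hΛ Ω) (hΛ Ω') (hΓ Ω) (hΓ Ω')
  -- Two lifts of one cocycle have equal images, so the comparison of nearby lifts applies.
  · rw [hκ.isRounding_iff h2 (hκ.exists_near_triple Ω.2 hΛ')] at hΓ'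
    refine hκ.mk_eq_mk_of_near hε (fun i j y => .inl ?_) (hΓ Ω) hΓ'
    rw [hΛ', hΛ]
  · funext a
    obtain ⟨Ω, rfl⟩ := Quotient.exists_rep a
    exact hdel Ω (Λ Ω) (Γ Ω) (hΛ Ω)
      ((hκ.isRounding_iff h2 (hκ.exists_near_triple Ω.2 (hΛ Ω))).2 (hΓ Ω))

theorem connectingMap_eq_of_distH_lt (hU : IsGoodFamily U) (hεδ : ε ≤ δ) (hδ : 8 * δ ≤ s)
    {del : H1 U H ε → H2 U F} (hdel : IsConnectingMap κ ζ del) {a b : H1 U H ε}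
    (hab : distH a b < δ) : del a = del b := by
  have hε : 8 * ε ≤ s := le_trans (by gcongr) hδ
  have h2 : ε + ε ≤ s := le_trans (by rw [← two_mul]; gcongr; norm_num) hε
  simp only [distH, iInf_lt_iff] at hab
  obtain ⟨Ω, Ω', rfl, rfl, hlt⟩ := hab
  obtain ⟨Λ, Γ, hΛ, hΓ⟩ := hκ.exists_isLift_near (F := F) hU hε Ω
  obtain ⟨Λ', Γ', hΛ', hΓ'⟩ := hκ.exists_isLift_near (F := F) hU hε Ω'
  rw [hdel Ω Λ Γ hΛ ((hκ.isRounding_iff h2 (hκ.exists_near_triple Ω.2 hΛ)).2 hΓ),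
    hdel Ω' Λ' Γ' hΛ' ((hκ.isRounding_iff h2 (hκ.exists_near_triple Ω'.2 hΛ')).2 hΓ')]
  refine hκ.mk_eq_mk_of_near hδ (fun i j y => Near.symm (.inr ?_))
    (fun i j k y => (hΓ i j k y).mono hεδ) (fun i j k y => (hΓ' i j k y).mono hεδ)
  rw [hΛ, hΛ']
  exact lt_of_le_of_lt (le_iSup_of_le i (le_iSup_of_le j
    (le_iSup (fun y => edist (Ω.1.val i j y) (Ω'.1.val i j y)) y))) hlt

end IsMetricExtension

/-! ### From Lie group extensions to metric extensions -/

section CentralExtension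

variable {EH : Type*} [NormedAddCommGroup EH] [NormedSpace ℝ EH]
  {H : Type*} [EMetricSpace H] [ChartedSpace EH H] [Group H]
  {EG : Type*} [NormedAddCommGroup EG] [NormedSpace ℝ EG]
  {G : Type*} [EMetricSpace G] [ChartedSpace EG G] [Group G]

theorem IsCentralExtension.isCoveringMap [LieGroup 𝓘(ℝ, EG) ∞ G] {F : Type*} [CommGroup F]
    [TopologicalSpace F] [DiscreteTopology F] {κ : F →* G} {ζ : G →* H}
    (hext : IsCentralExtension EH EG κ ζ) : IsCoveringMap ζ := by
  have : IsTopologicalGroup G := topologicalGroup_of_lieGroup 𝓘(ℝ, EG) ∞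
  have hq : Topology.IsQuotientMap ζ :=
    hext.isOpenMap.isQuotientMap hext.smooth.continuous hext.surjective
  refine (hq.isQuotientCoveringMap_of_isDiscrete_ker_monoidHom ?_).isCoveringMap
  rw [← hext.exact, MonoidHom.coe_range]
  exact ⟨hext.isEmbedding.toHomeomorph.symm.isEmbedding.discreteTopology⟩

variable [RiemannianBundle (fun x : H ↦ TangentSpace 𝓘(ℝ, EH) x)]
  [RiemannianBundle (fun x : G ↦ TangentSpace 𝓘(ℝ, EG) x)]

theorem IsPullbackMetric.enorm_mfderiv {ζ : G →* H} (h : IsPullbackMetric EH EG ζ) (g : G)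
    (v : TangentSpace 𝓘(ℝ, EG) g) : ‖mfderiv 𝓘(ℝ, EG) 𝓘(ℝ, EH) ζ g v‖ₑ = ‖v‖ₑ :=
  (enorm_eq_enorm_of_inner_eq (h g v v)).symm

/-- If `ζ` intertwines a self-map of `G` with a norm-preserving self-map of `H`, then the former
preserves the norms of the pullback metric. -/
theorem IsPullbackMetric.enorm_mfderiv_of_semiconj {ζ : G →* H} (h : IsPullbackMetric EH EG ζ)
    (hζ : MDifferentiable 𝓘(ℝ, EG) 𝓘(ℝ, EH) ζ) {φ : G → G} {ψ : H → H}
    (hφ : MDifferentiable 𝓘(ℝ, EG) 𝓘(ℝ, EG) φ) (hψ : MDifferentiable 𝓘(ℝ, EH) 𝓘(ℝ, EH) ψ)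
    (hsemi : ζ ∘ φ = ψ ∘ ζ)
    (hnorm : ∀ x (v : TangentSpace 𝓘(ℝ, EH) x), ‖mfderiv 𝓘(ℝ, EH) 𝓘(ℝ, EH) ψ x v‖ₑ = ‖v‖ₑ)
    (g : G) (v : TangentSpace 𝓘(ℝ, EG) g) : ‖mfderiv 𝓘(ℝ, EG) 𝓘(ℝ, EG) φ g v‖ₑ = ‖v‖ₑ := by
  have key : ‖mfderiv 𝓘(ℝ, EG) 𝓘(ℝ, EH) (ζ ∘ φ) g v‖ₑ =
      ‖mfderiv 𝓘(ℝ, EG) 𝓘(ℝ, EH) (ψ ∘ ζ) g v‖ₑ := by rw [hsemi]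
  rw [mfderiv_comp g (hζ (φ g)) (hφ g), mfderiv_comp g (hψ (ζ g)) (hζ g)] at key
  exact (h.enorm_mfderiv _ _).symm.trans
    (key.trans ((hnorm _ _).trans (h.enorm_mfderiv _ _)))

variable [LieGroup 𝓘(ℝ, EG) ∞ G] [IsRiemannianManifold 𝓘(ℝ, EG) G]

theorem isIsometricSMul_of_enorm_mfderiv
    (h : ∀ a x : G, ∀ v : TangentSpace 𝓘(ℝ, EG) x,
      ‖mfderiv 𝓘(ℝ, EG) 𝓘(ℝ, EG) (fun g : G ↦ a * g) x v‖ₑ = ‖v‖ₑ) :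
    IsIsometricSMul G G := by
  have hle : ∀ a x y : G, edist (a * x) (a * y) ≤ edist x y := fun a x y =>
    edist_map_le ((contMDiff_mul_left (I := 𝓘(ℝ, EG)) (n := ∞) (a := a)).of_le (by simp)) (h a) x y
  refine ⟨fun a x y => le_antisymm (hle a x y) ?_⟩
  -- Translation by the inverse is also nonexpanding, which gives the reverse inequality.
  simpa using hle a⁻¹ (a * x) (a * y)

theorem isIsometricSMul_op_of_enorm_mfderiv
    (h : ∀ a x : G, ∀ v : TangentSpace 𝓘(ℝ, EG) x,
      ‖mfderiv 𝓘(ℝ, EG) 𝓘(ℝ, EG) (fun g : G ↦ g * a) x v‖ₑ = ‖v‖ₑ) :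
    IsIsometricSMul Gᵐᵒᵖ G := by
  have hle : ∀ a x y : G, edist (x * a) (y * a) ≤ edist x y := fun a x y =>
    edist_map_le ((contMDiff_mul_right (I := 𝓘(ℝ, EG)) (n := ∞) (a := a)).of_le (by simp)) (h a) x y
  refine ⟨fun a x y => le_antisymm (hle a.unop x y) ?_⟩
  simpa using hle a.unop⁻¹ (x * a.unop) (y * a.unop)

variable [LieGroup 𝓘(ℝ, EH) ∞ H]

/-- The pullback of a biinvariant metric is biinvariant. -/
theorem IsPullbackMetric.isIsometricSMul {ζ : G →* H} (h : IsPullbackMetric EH EG ζ)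
    (hbi : IsBiinvariant EH H) (hζ : MDifferentiable 𝓘(ℝ, EG) 𝓘(ℝ, EH) ζ) :
    IsIsometricSMul G G ∧ IsIsometricSMul Gᵐᵒᵖ G := by
  constructor
  · refine isIsometricSMul_of_enorm_mfderiv (EG := EG) fun a => ?_
    exact h.enorm_mfderiv_of_semiconj hζ (ψ := fun x => ζ a * x)
      ((contMDiff_mul_left (I := 𝓘(ℝ, EG)) (n := ∞)).mdifferentiable (by simp))
      ((contMDiff_mul_left (I := 𝓘(ℝ, EH)) (n := ∞)).mdifferentiable (by simp))
      (by ext; simp) fun x v => enorm_eq_enorm_of_inner_eq (hbi.1 (ζ a) x v v)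
  · refine isIsometricSMul_op_of_enorm_mfderiv (EG := EG) fun a => ?_
    exact h.enorm_mfderiv_of_semiconj hζ (ψ := fun x => x * ζ a)
      ((contMDiff_mul_right (I := 𝓘(ℝ, EG)) (n := ∞)).mdifferentiable (by simp))
      ((contMDiff_mul_right (I := 𝓘(ℝ, EH)) (n := ∞)).mdifferentiable (by simp))
      (by ext; simp) fun x v => enorm_eq_enorm_of_inner_eq (hbi.2 (ζ a) x v v)

theorem IsCentralExtension.isMetricExtension [IsRiemannianManifold 𝓘(ℝ, EH) H]
    [FiniteDimensional ℝ EH] [FiniteDimensional ℝ EG]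
    {F : Type*} [CommGroup F] [TopologicalSpace F]
    [DiscreteTopology F] {κ : F →* G} {ζ : G →* H} (hext : IsCentralExtension EH EG κ ζ)
    (hpull : IsPullbackMetric EH EG ζ) : IsMetricExtension κ ζ (systole H) := by
  have hcov := hext.isCoveringMap
  have hζ : ContMDiff 𝓘(ℝ, EG) 𝓘(ℝ, EH) 1 ζ := hext.smooth.of_le (by simp)
  have hmap : ∀ f, ζ (κ f) = 1 := fun f => by
    have : κ f ∈ ζ.ker := hext.exact ▸ ⟨f, rfl⟩
    exact this
  have : LieGroup 𝓘(ℝ, EG) 1 G := .of_le (n := ∞) (by simp)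
  have : LieGroup 𝓘(ℝ, EH) 1 H := .of_le (n := ∞) (by simp)
  exact
    { isEmbedding := hext.isEmbedding
      central := hext.central
      exact := hext.exact
      surjective := hext.surjective
      isCoveringMap := hcov
      le_edist := fun f f' hne => systole_le_edist_of_isCoveringMap hcov hζ hpull.enorm_mfderiv
        (by rw [hmap, hmap]) (hext.isEmbedding.injective.ne hne)
      lift_edist := fun g h r hr => exists_edist_lt_of_isCoveringMap hcov hζ hpull.enorm_mfderiv hr }

end CentralExtension

end ApproxCech

theorem theorem6p4
    -- the compact Lie group `H`, with the geodesic distance of a Riemannian metric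
    {EH : Type*} [NormedAddCommGroup EH] [NormedSpace ℝ EH] [FiniteDimensional ℝ EH]
    {H : Type*} [EMetricSpace H] [ChartedSpace EH H] [Group H] [LieGroup 𝓘(ℝ, EH) ∞ H]
    [IsTopologicalGroup H] [CompactSpace H]
    [RiemannianBundle (fun x : H ↦ TangentSpace 𝓘(ℝ, EH) x)]
    [IsContMDiffRiemannianBundle 𝓘(ℝ, EH) ∞ EH (fun x : H ↦ TangentSpace 𝓘(ℝ, EH) x)]
    [IsRiemannianManifold 𝓘(ℝ, EH) H]
    -- the Lie group `G`, with the geodesic distance of a Riemannian metric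
    {EG : Type*} [NormedAddCommGroup EG] [NormedSpace ℝ EG] [FiniteDimensional ℝ EG]
    {G : Type*} [EMetricSpace G] [ChartedSpace EG G] [Group G] [LieGroup 𝓘(ℝ, EG) ∞ G]
    [RiemannianBundle (fun x : G ↦ TangentSpace 𝓘(ℝ, EG) x)]
    [IsContMDiffRiemannianBundle 𝓘(ℝ, EG) ∞ EG (fun x : G ↦ TangentSpace 𝓘(ℝ, EG) x)]
    [IsRiemannianManifold 𝓘(ℝ, EG) G]
    -- the discrete group `F` and the central extension
    {F : Type*} [CommGroup F] [TopologicalSpace F] [DiscreteTopology F]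
    (κ : F →* G) (ζ : G →* H)
    (hext : ApproxCech.IsCentralExtension EH EG κ ζ)
    -- the metric of `H` is biinvariant, and `G` carries its pullback
    (hbi : ApproxCech.IsBiinvariant EH H)
    (hpull : ApproxCech.IsPullbackMetric EH EG ζ)
    -- the open cover
    {B : Type*} [TopologicalSpace B] {J : Type*} (U : J → Opens B) (hcover : IsOpenCover U)
    (hU : ApproxCech.IsGoodFamily U)
    (ε : ℝ≥0∞) (hε : ε ≤ ApproxCech.systole H / 8) :
    -- approximate cocycles have lifts
    (∀ Ω : ApproxCech.Z1 U H ε, ∃ Λ : ApproxCech.Cochain1 U G, ApproxCech.IsLift ζ Λ Ω.1) ∧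
    -- for each lift, closest points exist, are unique, and form a continuous `2`-cocycle
    (∀ (Ω : ApproxCech.Z1 U H ε) (Λ : ApproxCech.Cochain1 U G), ApproxCech.IsLift ζ Λ Ω.1 →
      ∃ Γ : ApproxCech.Z2 U F, ∀ (i j k : J) (y : ↥(U i ⊓ U j ⊓ U k)) (f : F),
        ApproxCech.IsClosest κ (ApproxCech.triple Λ i j k y) f ↔ f = Γ.1 i j k y) ∧
    -- the map on cohomology: well defined, independent of the lifts, and stable
    (∃! del : ApproxCech.H1 U H ε → ApproxCech.H2 U F, ApproxCech.IsConnectingMap κ ζ del) ∧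
    (∀ del : ApproxCech.H1 U H ε → ApproxCech.H2 U F, ApproxCech.IsConnectingMap κ ζ del →
      ∀ a b : ApproxCech.H1 U H ε,
        ApproxCech.distH a b < ApproxCech.systole H / 8 → del a = del b) := by
  have : IsTopologicalGroup G := topologicalGroup_of_lieGroup 𝓘(ℝ, EG) ∞
  obtain ⟨_, _⟩ := hpull.isIsometricSMul hbi (hext.smooth.mdifferentiable (by simp))
  have hκ := hext.isMetricExtension hpull
  have hδ : 8 * (ApproxCech.systole H / 8) ≤ ApproxCech.systole H := ENNReal.mul_div_le
  have h8 : 8 * ε ≤ ApproxCech.systole H := le_trans (by gcongr) hδ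
  have h2 : ε + ε ≤ ApproxCech.systole H :=
    le_trans (by rw [← two_mul]; gcongr; norm_num) h8
  refine ⟨fun Ω => hκ.exists_isLift hU Ω.2 h2, fun Ω Λ hΛ => ?_,
    hκ.existsUnique_isConnectingMap hU h8,
    fun del hdel a b hab => hκ.connectingMap_eq_of_distH_lt hU hε hδ hdel hab⟩
  obtain ⟨Γ, hΓ⟩ := hκ.exists_near_Z2 Ω.2 h8 hΛ
  exact ⟨Γ, fun i j k y f => hκ.isClosest_iff (hΓ i j k y) h2⟩
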